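/- Let $n\ge 2$, let $\Delta\subset\mathbb{R}^n$ be a compact convex set with non-empty interior, let $p_1\colon\mathbb{R}^n\to\mathbb{R}$ be the first projection and write $[t_0,t_1]:=p_1(\Delta)$. Let $V:=\operatorname{vol}_{\mathbb{R}^n}(\Delta)$, let $(b_1,\dots,b_n)$ be the barycenter of $\Delta$, and for $x\in[t_0,t_1]$ let $g(x):=\operatorname{vol}_{\mathbb{R}^{n-1}}(\Delta_x)$, where $\Delta_x:=\{y\in\mathbb{R}^{n-1} : (x,y)\in\Delta\}$. Fix $e\in(t_0,t_1)$ and set $A:=\int_{t_0}^e g(x)\,dx$. **(1)** Assume that $v\in\mathbb{R}$ is the right or the left derivative of $g$ at $e$, i.e. $v=\lim_{x\to e+0}\frac{g(x)-g(e)}{x-e}$ or $v=\lim_{x\to e-0}\frac{g(x)-g(e)}{x-e}$. Put $h_0(x):=g(x)$ for $x\in[t_0,e]$ and $$h_0(x):=g(e)\left(\frac{v(x-e)}{(n-1)g(e)}+1\right)^{n-1}\qquad\text{for }x\in[e,t_1].$$ (i) We have $g(x)\le h_0(x)$ for all $x\in[t_0,t_1]$. Moreover $$b_1\ge\frac1V\int_{t_0}^{s_0}x\,h_0(x)\,dx,$$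 where $s_0\in(e,t_1]$ is given by $$s_0:=\begin{cases}e+\frac{(n-1)g(e)}{v}\left(\left(\frac{nv(V-A)+(n-1)g(e)^2}{(n-1)g(e)^2}\right)^{1/n}-1\right)&\text{if }v\ne0,\\ e+\frac{1}{g(e)}(V-A)&\text{if }v=0.\end{cases}$$ (ii) For $t\in(e,t_1]$ put $W:=\int_{t_0}^t h_0(x)\,dx$. Then $$W=\begin{cases}A+\frac{(n-1)g(e)^2}{nv}\left(\left(\frac{v(t-e)}{(n-1)g(e)}+1\right)^n-1\right)&\text{if }v\neq0,\\ A+(t-e)g(e)&\text{if }v=0,\end{cases}$$ and $W\ge V$ holds for $t=t_1$. Assume that $t\in(e,t_1]$ satisfies $W\ge V$, and set $$s_1:=\begin{cases}e+\frac{(n-1)g(e)}{v}\left(\left(\frac{nv(V-A)+(n-1)g(e)^2}{g(e)\left(v(t-e)+(n-1)g(e)\right)}\right)^{\frac1{n-1}}-1\right)&\text{if }v\ne0,\\ \frac{n(V-A)-g(e)(t-ne)}{(n-1)g(e)}&\text{if }v=0,\end{cases}$$ where we put $s_1:=t$ in the degenerate case $v(t-e)+(n-1)g(e)=0$. Then $s_1\in[e,t]$,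 and outside the degenerate case $$s_1=\begin{cases}e+\frac{(n-1)g(e)}{v}\left(\left(\frac{(n-1)g(e)^2\left(\frac{v(t-e)}{(n-1)g(e)}+1\right)^n-nv(W-V)}{g(e)\left(v(t-e)+(n-1)g(e)\right)}\right)^{\frac1{n-1}}-1\right)&\text{if }v\neq0,\\ t-\frac{n(W-V)}{(n-1)g(e)}&\text{if }v=0.\end{cases}$$ Put $h_1(x):=h_0(x)$ for $x\in[t_0,s_1]$ and $h_1(x):=h_0(s_1)\left(\frac{t-x}{t-s_1}\right)^{n-1}$ for $x\in(s_1,t]$. Then $$b_1\ge\frac1V\int_{t_0}^t x\,h_1(x)\,dx.$$ **(2)** For every $u\in[t_1,\infty)$ we have $\int_e^u g(e)\left(\frac{u-x}{u-e}\right)^{n-1}dx=\frac{(u-e)g(e)}{n}$. Assume that $u\in[t_1,\infty)$ satisfies $$A+\int_e^u g(e)\left(\frac{u-x}{u-e}\right)^{n-1}dx\le V$$ (this holds for $u=t_1$). Let $w\in\mathbb{R}_{\ge0}$ satisfy $F(w)\ge0$, where $$F(w):=(u-e)\sum_{i=0}^{n-1}g(e)^{\frac{i}{n-1}}w^{n-1-i}-n(V-A),$$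 and assume that $e\ge0$ or $F(w)=0$. Put $h_2(x):=g(x)$ for $x\in[t_0,e]$ and $$h_2(x):=\left(\frac{u-x}{u-e}\,g(e)^{\frac1{n-1}}+\frac{x-e}{u-e}\,w\right)^{n-1}\qquad\text{for }x\in[e,u].$$ Then $$b_1\le\frac1V\int_{t_0}^u x\,h_2(x)\,dx.$$ -/

import Mathlib

open MeasureTheory Set Filter Topology

noncomputable section

namespace ConvexSlice

/-! The ambient space is `ℝⁿ` with `n = d + 1`, realized as `Fin (d + 1) → ℝ` with Lebesgue measure;
the first coordinate of `y` is `y 0`. -/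

/-- The slice `Δ_x = p₁⁻¹({x})` of `Δ`, as a subset of `ℝ^{n-1}`. -/
def slice {d : ℕ} (Δ : Set (Fin (d + 1) → ℝ)) (x : ℝ) : Set (Fin d → ℝ) :=
  {y | (Fin.cons x y : Fin (d + 1) → ℝ) ∈ Δ}

/-- `g(x) = vol_{n-1}(Δ_x)`. -/
def sliceVol {d : ℕ} (Δ : Set (Fin (d + 1) → ℝ)) (x : ℝ) : ℝ :=
  volume.real (slice Δ x)

/-- The barycenter of a body in `ℝᵏ`. -/
def barycenter {k : ℕ} (Δ : Set (Fin k → ℝ)) : Fin k → ℝ :=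
  (volume.real Δ)⁻¹ • ∫ y in Δ, y

/-- `h₀`: equal to `g` up to `e`, and to `g(e) (v (x - e) / ((n-1) g(e)) + 1)^{n-1}` beyond. -/
def h₀ (d : ℕ) (g : ℝ → ℝ) (e v x : ℝ) : ℝ :=
  if x ≤ e then g x else g e * (v * (x - e) / (d * g e) + 1) ^ d

/-- The cut-off point `s₀`; here `A` stands for `∫_{t₀}^e g` and `ge` for `g(e)`. -/
def s₀ (d : ℕ) (V A ge e v : ℝ) : ℝ :=
  if v = 0 then e + 1 / ge * (V - A)
  else e + d * ge / v *
    ((((d + 1) * v * (V - A) + d * ge ^ 2) / (d * ge ^ 2)) ^ (1 / ((d : ℝ) + 1)) - 1)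

/-- The point `s₁`; here `A` stands for `∫_{t₀}^e g` and `ge` for `g(e)`. If the denominator
`v (t - e) + (n-1) g(e)` vanishes, then `s₁ = t`. -/
def s₁ (d : ℕ) (V A ge e v t : ℝ) : ℝ :=
  if v = 0 then ((d + 1) * (V - A) - ge * (t - (d + 1) * e)) / (d * ge)
  else if v * (t - e) + d * ge = 0 then t
  else e + d * ge / v *
    ((((d + 1) * v * (V - A) + d * ge ^ 2) / (ge * (v * (t - e) + d * ge))) ^ (1 / (d : ℝ)) - 1)

/-- `h₁`: equal to `h₀` up to `s`, followed on `[s, t]` by a cone with vertex at `t`. -/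
def h₁ (d : ℕ) (g : ℝ → ℝ) (e v t s x : ℝ) : ℝ :=
  if x ≤ s then h₀ d g e v x else h₀ d g e v s * ((t - x) / (t - s)) ^ d

/-- `h₂`: equal to `g` up to `e`; on `[e, u]` its `(n-1)`-st root interpolates linearly between
`g(e)^{1/(n-1)}` and `w`. -/
def h₂ (d : ℕ) (g : ℝ → ℝ) (e u w x : ℝ) : ℝ :=
  if x ≤ e then g x
  else ((u - x) / (u - e) * g e ^ (1 / (d : ℝ)) + (x - e) / (u - e) * w) ^ d

/-- `F(w) = (u - e) ∑_{i=0}^{n-1} g(e)^{i/(n-1)} w^{n-1-i} - n (V - A)`, where `A` stands for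
`∫_{t₀}^e g` and `ge` for `g(e)`. -/
def F (d : ℕ) (V A ge e u w : ℝ) : ℝ :=
  (u - e) * (∑ i ∈ Finset.range (d + 1), ge ^ ((i : ℝ) / (d : ℝ)) * w ^ (d - i))
    - (d + 1) * (V - A)

end ConvexSlice

end

namespace ConvexSlice

open scoped Pointwise

/-! ### Slices of compact sets and Fubini's theorem -/

/-! Write `n = d + 1`. By Fubini, `V` is the integral of `g` and `V * b₁` is the integral of `x * g
x`, so every bound on `b₁` compares the first moment of `g` with that of a model function. The
geometric input is Brunn's theorem (`concaveOn_sliceVol_rpow`): the `d`-th root of `g` is concave on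
`[t₀, t₁]`. Brunn's theorem rests on the Brunn–Minkowski inequality. Its one-dimensional case,
applied to superlevel sets, gives Prékopa–Leindler on the line; induction over slices gives the
multiplicative inequality in all dimensions, and rescaling to unit volume gives the additive one.
The comparison principle is `mul_integral_sub_le_of_crossing`: if `f₂ - f₁` changes sign only at
`r`, from negative to positive, then `(x - r) * (f₂ x - f₁ x)` is nonnegative, so the moments differ
by at least `r` times the difference of masses. All model functions have affine `d`-th roots beyond
`e`, piecewise for `h₁`, and concavity of the root of `g` forces single crossings. The line with
slope given by `v` supports that root at `e`, whence `g ≤ h₀`; cones lie below `g` because chords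
lie below a concave function. The cut-offs `s₀` and `s₁` make the truncated models have mass `V`.
The intermediate value theorem provides such points, and explicit integration identifies them with
the closed formulas. -/

lemma continuous_cons_prod (d : ℕ) :
    Continuous (fun p : ℝ × (Fin d → ℝ) => (Fin.cons p.1 p.2 : Fin (d + 1) → ℝ)) := by
  refine continuous_pi fun i => ?_
  refine Fin.cases ?_ (fun j => ?_) i
  · simpa using continuous_fst
  · simpa only [Fin.cons_succ] using (continuous_apply j).comp' continuous_snd

lemma slice_subset_image_tail {d : ℕ} (K : Set (Fin (d + 1) → ℝ)) (x : ℝ) :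
    slice K x ⊆ (fun y : Fin (d + 1) → ℝ => Fin.tail y) '' K :=
  fun y hy => ⟨Fin.cons x y, hy, Fin.tail_cons _ _⟩

lemma isCompact_image_tail {d : ℕ} {K : Set (Fin (d + 1) → ℝ)} (hK : IsCompact K) :
    IsCompact ((fun y : Fin (d + 1) → ℝ => Fin.tail y) '' K) :=
  hK.image (continuous_pi fun i => continuous_apply i.succ)

lemma isCompact_slice {d : ℕ} {K : Set (Fin (d + 1) → ℝ)} (hK : IsCompact K) (x : ℝ) :
    IsCompact (slice K x) := by
  refine (isCompact_image_tail hK).of_isClosed_subset ?_ (slice_subset_image_tail K x)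
  exact hK.isClosed.preimage
    ((continuous_cons_prod d).comp (continuous_const.prodMk continuous_id))

lemma sliceVol_nonneg {d : ℕ} (K : Set (Fin (d + 1) → ℝ)) (x : ℝ) : 0 ≤ sliceVol K x :=
  measureReal_nonneg

lemma exists_sliceVol_le {d : ℕ} {K : Set (Fin (d + 1) → ℝ)} (hK : IsCompact K) :
    ∃ C, ∀ x, sliceVol K x ≤ C :=
  ⟨_, fun x => measureReal_mono (slice_subset_image_tail K x)
    (isCompact_image_tail hK).measure_lt_top.ne⟩

lemma measurable_sliceVol {d : ℕ} {K : Set (Fin (d + 1) → ℝ)} (hK : IsCompact K) :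
    Measurable (sliceVol K) := by
  have hP : MeasurableSet ((fun p : ℝ × (Fin d → ℝ) => (Fin.cons p.1 p.2 : Fin (d + 1) → ℝ)) ⁻¹' K) :=
    (hK.isClosed.preimage (continuous_cons_prod d)).measurableSet
  exact (measurable_measure_prodMk_left (ν := volume) hP).ennreal_toReal

/-- Used with `f = 1` for the volume and with `f = id` for the barycenter. -/
lemma integrable_and_setIntegral_eq_integral_slice {d : ℕ} {K : Set (Fin (d + 1) → ℝ)}
    (hK : IsCompact K) {f : ℝ → ℝ} (hf : Continuous f) :
    Integrable (fun x => f x * sliceVol K x) ∧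
      ∫ y in K, f (y 0) = ∫ x, f x * sliceVol K x := by
  set E := (MeasurableEquiv.piFinSuccAbove (fun _ : Fin (d + 1) => ℝ) 0).symm with hE
  have hEp : MeasurePreserving E volume volume :=
    (volume_preserving_piFinSuccAbove (fun _ : Fin (d + 1) => ℝ) 0).symm _
  have hEa : ∀ p, E p = (Fin.cons p.1 p.2 : Fin (d + 1) → ℝ) := by
    intro p
    rw [hE, MeasurableEquiv.piFinSuccAbove_symm_apply]
    simp [Fin.insertNthEquiv]
  have hint : Integrable (K.indicator fun y : Fin (d + 1) → ℝ => f (y 0)) := by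
    rw [integrable_indicator_iff hK.measurableSet]
    exact (hf.comp (continuous_apply 0)).continuousOn.integrableOn_compact hK
  have hint' : Integrable (fun p => K.indicator (fun y : Fin (d + 1) → ℝ => f (y 0)) (E p)) :=
    hEp.integrable_comp_of_integrable hint
  have hslice : ∀ x, ∫ z, K.indicator (fun y : Fin (d + 1) → ℝ => f (y 0)) (E (x, z)) =
      f x * sliceVol K x := by
    intro x
    have : (fun z => K.indicator (fun y : Fin (d + 1) → ℝ => f (y 0)) (E (x, z))) =
        (slice K x).indicator fun _ => f x := by
      funext z
      have hm : E (x, z) ∈ K ↔ z ∈ slice K x := by rw [hEa]; rfl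
      by_cases hz : z ∈ slice K x
      · rw [indicator_of_mem (hm.2 hz), indicator_of_mem hz, hEa, Fin.cons_zero]
      · rw [indicator_of_notMem (mt hm.1 hz), indicator_of_notMem hz]
    rw [this, integral_indicator (isCompact_slice hK x).measurableSet, setIntegral_const,
      smul_eq_mul, mul_comm]
    rfl
  constructor
  · have := hint'.integral_prod_left
    simpa only [hslice] using this
  · rw [← integral_indicator hK.measurableSet, ← hEp.integral_comp' ]
    rw [show (volume : Measure (ℝ × (Fin d → ℝ))) = volume.prod volume from rfl] at *
    rw [integral_prod _ hint']
    simp only [hslice]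

lemma integrable_sliceVol {d : ℕ} {K : Set (Fin (d + 1) → ℝ)} (hK : IsCompact K) :
    Integrable (sliceVol K) := by
  simpa using (integrable_and_setIntegral_eq_integral_slice hK (f := fun _ => 1)
    continuous_const).1

lemma volume_real_eq_integral_sliceVol {d : ℕ} {K : Set (Fin (d + 1) → ℝ)} (hK : IsCompact K) :
    volume.real K = ∫ x, sliceVol K x := by
  simpa using (integrable_and_setIntegral_eq_integral_slice hK (f := fun _ => 1)
    continuous_const).2

/-! ### The Prékopa–Leindler inequality on the line -/

lemma volume_image_mul_add {a : ℝ} (ha : 0 ≤ a) (c : ℝ) (K : Set ℝ) :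
    volume ((fun x => a * x + c) '' K) = ENNReal.ofReal a * volume K := by
  have : (fun x => a * x + c) '' K = (fun x => x + c) '' (a • K) := by
    rw [← image_smul, image_image]; rfl
  rw [this, image_add_right, measure_preimage_add_right, Measure.addHaar_smul]
  simp [abs_of_nonneg ha]

/-- `C` contains the translates `a K + b min L` and `a max K + b L`, which meet at most in the point
`a max K + b min L`. -/
lemma volume_add_le_of_isCompact {a b : ℝ} (ha : 0 ≤ a) (hb : 0 ≤ b) {K L C : Set ℝ}
    (hK : IsCompact K) (hL : IsCompact L) (hK0 : K.Nonempty) (hL0 : L.Nonempty)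
    (hC : ∀ x ∈ K, ∀ y ∈ L, a * x + b * y ∈ C) :
    ENNReal.ofReal a * volume K + ENNReal.ofReal b * volume L ≤ volume C := by
  obtain ⟨x₁, hx₁, hx₁'⟩ := hK.exists_isGreatest hK0
  obtain ⟨y₀, hy₀, hy₀'⟩ := hL.exists_isLeast hL0
  rw [← volume_image_mul_add ha (b * y₀), ← volume_image_mul_add hb (a * x₁)]
  have hdisj : AEDisjoint volume ((fun x => a * x + b * y₀) '' K)
      ((fun x => b * x + a * x₁) '' L) := by
    refine measure_mono_null (t := {a * x₁ + b * y₀}) ?_ (by simp)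
    rintro _ ⟨⟨x, hx, rfl⟩, ⟨y, hy, hxy⟩⟩
    have h1 := mul_le_mul_of_nonneg_left (hx₁' hx) ha
    have h2 := mul_le_mul_of_nonneg_left (hy₀' hy) hb
    simp only [mem_singleton_iff]
    dsimp only at hxy
    linarith
  rw [← measure_union₀ _ hdisj]
  · refine measure_mono (union_subset ?_ ?_)
    · rintro _ ⟨x, hx, rfl⟩
      exact hC x hx y₀ hy₀
    · rintro _ ⟨y, hy, rfl⟩
      simpa only [add_comm] using hC x₁ hx₁ y hy
  · exact (hL.image (by fun_prop)).measurableSet.nullMeasurableSet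

/-- The Brunn–Minkowski inequality on the line. -/
lemma volume_add_le_of_measurableSet {a b : ℝ} (ha : 0 ≤ a) (hb : 0 ≤ b) {S T C : Set ℝ}
    (hS : MeasurableSet S) (hT : MeasurableSet T) (hS0 : S.Nonempty) (hT0 : T.Nonempty)
    (hC : ∀ x ∈ S, ∀ y ∈ T, a * x + b * y ∈ C) :
    ENNReal.ofReal a * volume S + ENNReal.ofReal b * volume T ≤ volume C := by
  obtain ⟨x₀, hx₀⟩ := hS0
  obtain ⟨y₀, hy₀⟩ := hT0
  rw [hS.measure_eq_iSup_isCompact, hT.measure_eq_iSup_isCompact]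
  have key := ENNReal.biSup_add_biSup_le' (p := fun K : Set ℝ => K ⊆ S ∧ IsCompact K)
    (q := fun K : Set ℝ => K ⊆ T ∧ IsCompact K) (f := fun K => ENNReal.ofReal a * volume K)
    (g := fun K => ENNReal.ofReal b * volume K) (a := volume C)
    ⟨∅, empty_subset _, isCompact_empty⟩ ⟨∅, empty_subset _, isCompact_empty⟩ ?_
  · simpa only [ENNReal.mul_iSup, iSup_and] using key
  · rintro K ⟨hKS, hK⟩ L ⟨hLT, hL⟩
    -- The inner compact sets may be empty; adding one point of `S` and of `T` repairs this.
    refine le_trans ?_ (volume_add_le_of_isCompact ha hb (hK.insert x₀) (hL.insert y₀)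
      (insert_nonempty _ _) (insert_nonempty _ _) (C := C) ?_)
    · gcongr <;> exact subset_insert _ _
    · intro x hx y hy
      exact hC x (insert_subset hx₀ hKS hx) y (insert_subset hy₀ hLT hy)

/-- The additive form of the Prékopa–Leindler inequality for functions with supremum `1`. -/
lemma integral_add_le_of_iSup_eq_one {a b : ℝ} (ha : 0 < a) (hb : 0 < b) (hab : a + b = 1)
    {f g h : ℝ → ℝ} (hf0 : ∀ x, 0 ≤ f x) (hg0 : ∀ x, 0 ≤ g x) (hh0 : ∀ x, 0 ≤ h x)
    (hfm : Measurable f) (hgm : Measurable g)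
    (hfi : Integrable f) (hgi : Integrable g) (hhi : Integrable h)
    (hf1 : IsLUB (range f) 1) (hg1 : IsLUB (range g) 1)
    (H : ∀ x y, f x ^ a * g y ^ b ≤ h (a * x + b * y)) :
    a * (∫ x, f x) + b * (∫ x, g x) ≤ ∫ x, h x := by
  have key : ENNReal.ofReal a * (∫⁻ x, ENNReal.ofReal (f x)) +
      ENNReal.ofReal b * (∫⁻ x, ENNReal.ofReal (g x)) ≤ ∫⁻ x, ENNReal.ofReal (h x) := by
    have hanti : ∀ φ : ℝ → ℝ, Measurable fun t : ℝ => volume {x | t < φ x} := fun φ =>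
      Antitone.measurable fun s t hst => measure_mono fun x (hx : t < φ x) => hst.trans_lt hx
    rw [lintegral_eq_lintegral_meas_lt _ (ae_of_all _ hf0) hfm.aemeasurable,
      lintegral_eq_lintegral_meas_lt _ (ae_of_all _ hg0) hgm.aemeasurable,
      lintegral_eq_lintegral_meas_lt _ (ae_of_all _ hh0) hhi.aemeasurable,
      ← lintegral_const_mul _ (hanti f), ← lintegral_const_mul _ (hanti g),
      ← lintegral_add_left ((hanti f).const_mul _)]
    refine setLIntegral_mono' measurableSet_Ioi fun t (ht : 0 < t) => ?_
    -- Layer-cake comparison: since both suprema are `1`, for `t < 1` both superlevel sets are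
    -- nonempty, and for `t ≥ 1` both are empty.
    rcases lt_or_ge t 1 with ht1 | ht1
    · obtain ⟨_, ⟨x, rfl⟩, hx⟩ := (lt_isLUB_iff hf1).1 ht1
      obtain ⟨_, ⟨y, rfl⟩, hy⟩ := (lt_isLUB_iff hg1).1 ht1
      refine volume_add_le_of_measurableSet ha.le hb.le (measurableSet_lt measurable_const hfm)
        (measurableSet_lt measurable_const hgm) ⟨x, hx⟩ ⟨y, hy⟩ fun x hx y hy => ?_
      refine lt_of_lt_of_le ?_ (H x y)
      calc t = t ^ a * t ^ b := by rw [← Real.rpow_add ht, hab, Real.rpow_one]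
        _ < f x ^ a * g y ^ b := by
          have h1 := Real.rpow_lt_rpow ht.le (show t < f x from hx) ha
          have h2 := Real.rpow_lt_rpow ht.le (show t < g y from hy) hb
          exact mul_lt_mul'' h1 h2 (by positivity) (by positivity)
    · have h1 : {x | t < f x} = ∅ := by
        ext x; simpa using (hf1.1 ⟨x, rfl⟩ : f x ≤ 1).trans ht1
      have h2 : {x | t < g x} = ∅ := by
        ext x; simpa using (hg1.1 ⟨x, rfl⟩ : g x ≤ 1).trans ht1
      simp [h1, h2]
  rw [← ofReal_integral_eq_lintegral_ofReal hfi (ae_of_all _ hf0),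
    ← ofReal_integral_eq_lintegral_ofReal hgi (ae_of_all _ hg0),
    ← ofReal_integral_eq_lintegral_ofReal hhi (ae_of_all _ hh0),
    ← ENNReal.ofReal_mul ha.le, ← ENNReal.ofReal_mul hb.le, ← ENNReal.ofReal_add] at key
  · exact (ENNReal.ofReal_le_ofReal_iff (integral_nonneg hh0)).1 key
  · exact mul_nonneg ha.le (integral_nonneg hf0)
  · exact mul_nonneg hb.le (integral_nonneg hg0)

/-- The Prékopa–Leindler inequality on the line, for bounded functions. -/
lemma integral_rpow_mul_integral_rpow_le {a b : ℝ} (ha : 0 < a) (hb : 0 < b) (hab : a + b = 1)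
    {f g h : ℝ → ℝ} (hf0 : ∀ x, 0 ≤ f x) (hg0 : ∀ x, 0 ≤ g x) (hh0 : ∀ x, 0 ≤ h x)
    (hfm : Measurable f) (hgm : Measurable g)
    (hfi : Integrable f) (hgi : Integrable g) (hhi : Integrable h)
    (hfb : BddAbove (range f)) (hgb : BddAbove (range g))
    (H : ∀ x y, f x ^ a * g y ^ b ≤ h (a * x + b * y)) :
    (∫ x, f x) ^ a * (∫ x, g x) ^ b ≤ ∫ x, h x := by
  have hM := isLUB_csSup (range_nonempty f) hfb
  have hN := isLUB_csSup (range_nonempty g) hgb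
  set M := sSup (range f)
  set N := sSup (range g)
  have hM0 : 0 ≤ M := (hf0 0).trans (hM.1 ⟨0, rfl⟩)
  have hN0 : 0 ≤ N := (hg0 0).trans (hN.1 ⟨0, rfl⟩)
  rcases hM0.eq_or_lt with hM0 | hM0
  · have : ∀ x, f x = 0 := fun x => le_antisymm (hM0 ▸ hM.1 ⟨x, rfl⟩) (hf0 x)
    simp only [this, integral_zero, Real.zero_rpow ha.ne', zero_mul]
    exact integral_nonneg hh0
  rcases hN0.eq_or_lt with hN0 | hN0
  · have : ∀ x, g x = 0 := fun x => le_antisymm (hN0 ▸ hN.1 ⟨x, rfl⟩) (hg0 x)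
    simp only [this, integral_zero, Real.zero_rpow hb.ne', mul_zero]
    exact integral_nonneg hh0
  have hscale : ∀ {φ : ℝ → ℝ} {B : ℝ}, 0 < B → IsLUB (range φ) B →
      IsLUB (range fun x => φ x / B) 1 := by
    intro φ B hB hφ
    refine ⟨?_, fun c hc => ?_⟩
    · rintro _ ⟨x, rfl⟩
      exact (div_le_one hB).2 (hφ.1 ⟨x, rfl⟩)
    · have : B ≤ c * B := hφ.2 (by
        rintro _ ⟨x, rfl⟩
        exact (div_le_iff₀ hB).1 (hc ⟨x, rfl⟩))
      nlinarith
  have hMN : 0 < M ^ a * N ^ b := by positivity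
  -- Dividing by the suprema allows the additive form; weighted AM–GM then returns the
  -- multiplicative one.
  have key := integral_add_le_of_iSup_eq_one ha hb hab (f := fun x => f x / M)
    (g := fun x => g x / N) (h := fun x => h x / (M ^ a * N ^ b))
    (fun x => div_nonneg (hf0 x) hM0.le) (fun x => div_nonneg (hg0 x) hN0.le)
    (fun x => div_nonneg (hh0 x) hMN.le) (hfm.div_const _) (hgm.div_const _)
    (hfi.div_const _) (hgi.div_const _) (hhi.div_const _) (hscale hM0 hM) (hscale hN0 hN)
    (fun x y => by
      rw [Real.div_rpow (hf0 x) hM0.le, Real.div_rpow (hg0 y) hN0.le, div_mul_div_comm]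
      exact div_le_div_of_nonneg_right (H x y) hMN.le)
  simp only [integral_div] at key
  have hF0 : 0 ≤ ∫ x, f x := integral_nonneg hf0
  have hG0 : 0 ≤ ∫ x, g x := integral_nonneg hg0
  have := (Real.geom_mean_le_arith_mean2_weighted ha.le hb.le (div_nonneg hF0 hM0.le)
    (div_nonneg hG0 hN0.le) hab).trans key
  rw [Real.div_rpow hF0 hM0.le, Real.div_rpow hG0 hN0.le, div_mul_div_comm] at this
  exact (div_le_div_iff_of_pos_right hMN).1 this

/-! ### The Brunn–Minkowski inequality -/

lemma smul_slice_add_smul_slice_subset {d : ℕ} (K L : Set (Fin (d + 1) → ℝ)) (a b x y : ℝ) :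
    a • slice K x + b • slice L y ⊆ slice (a • K + b • L) (a * x + b * y) := by
  rintro _ ⟨_, ⟨p, hp, rfl⟩, _, ⟨q, hq, rfl⟩, rfl⟩
  refine ⟨_, ⟨_, hp, rfl⟩, _, ⟨_, hq, rfl⟩, ?_⟩
  funext i
  refine Fin.cases ?_ (fun j => ?_) i <;> simp

lemma isCompact_smul_add_smul {d : ℕ} {K L : Set (Fin d → ℝ)} (hK : IsCompact K)
    (hL : IsCompact L) (a b : ℝ) : IsCompact (a • K + b • L) :=
  (hK.smul a).add (hL.smul b)

/-- The Brunn–Minkowski inequality for compact sets, in its multiplicative form. -/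
theorem volume_rpow_mul_volume_rpow_le {a b : ℝ} (ha : 0 < a) (hb : 0 < b) (hab : a + b = 1)
    {d : ℕ} {K L : Set (Fin d → ℝ)} (hK : IsCompact K) (hL : IsCompact L) :
    volume.real K ^ a * volume.real L ^ b ≤ volume.real (a • K + b • L) := by
  induction d with
  | zero =>
    rcases K.eq_empty_or_nonempty with rfl | hK0
    · simp [Real.zero_rpow ha.ne']
    rcases L.eq_empty_or_nonempty with rfl | hL0
    · simp [Real.zero_rpow hb.ne']
    have h1 := Subsingleton.eq_univ_of_nonempty hK0
    have h2 := Subsingleton.eq_univ_of_nonempty hL0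
    have h3 := Subsingleton.eq_univ_of_nonempty ((hK0.smul_set (a := a)).add (hL0.smul_set (a := b)))
    rw [h3, h1, h2]
    have : volume.real (univ : Set (Fin 0 → ℝ)) = 1 := by
      simp [Measure.real, volume_pi]
    simp [this]
  | succ d ih =>
    have hKL := isCompact_smul_add_smul hK hL a b
    rw [volume_real_eq_integral_sliceVol hK, volume_real_eq_integral_sliceVol hL,
      volume_real_eq_integral_sliceVol hKL]
    obtain ⟨C, hC⟩ := exists_sliceVol_le hK
    obtain ⟨D, hD⟩ := exists_sliceVol_le hL
    refine integral_rpow_mul_integral_rpow_le ha hb hab (sliceVol_nonneg K) (sliceVol_nonneg L)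
      (sliceVol_nonneg _) (measurable_sliceVol hK) (measurable_sliceVol hL)
      (integrable_sliceVol hK) (integrable_sliceVol hL) (integrable_sliceVol hKL)
      ⟨C, by rintro _ ⟨x, rfl⟩; exact hC x⟩ ⟨D, by rintro _ ⟨x, rfl⟩; exact hD x⟩ fun x y => ?_
    exact (ih (isCompact_slice hK x) (isCompact_slice hL y)).trans
      (measureReal_mono (smul_slice_add_smul_slice_subset K L a b x y)
        (isCompact_slice hKL _).measure_lt_top.ne)

lemma volume_real_smul {d : ℕ} {r : ℝ} (hr : 0 ≤ r) (K : Set (Fin d → ℝ)) :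
    volume.real (r • K) = r ^ d * volume.real K := by
  rw [Measure.real, Measure.addHaar_smul]
  simp [Measure.real, abs_of_nonneg (pow_nonneg hr d), pow_nonneg hr d]

/-- Covers the case of a null set in Brunn–Minkowski, where normalising volumes is impossible: the
sum contains a translate of `a • K`. -/
lemma smul_volume_rpow_le_of_nonempty {d : ℕ} (hd : d ≠ 0) {a b : ℝ} (ha : 0 ≤ a)
    {K L : Set (Fin d → ℝ)} (hK : IsCompact K) (hL : IsCompact L) (hL0 : L.Nonempty) :
    a * volume.real K ^ (1 / (d : ℝ)) ≤ volume.real (a • K + b • L) ^ (1 / (d : ℝ)) := by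
  obtain ⟨y, hy⟩ := hL0
  have h1 : volume.real (a • K) ≤ volume.real (a • K + b • L) := by
    have : (fun x => x + b • y) '' (a • K) ⊆ a • K + b • L := by
      rintro _ ⟨x, hx, rfl⟩
      exact ⟨x, hx, _, ⟨y, hy, rfl⟩, rfl⟩
    have h2 := measureReal_mono (μ := volume) this
      (isCompact_smul_add_smul hK hL a b).measure_lt_top.ne
    rwa [image_add_right, Measure.real, measure_preimage_add_right] at h2
  rw [volume_real_smul ha] at h1
  calc a * volume.real K ^ (1 / (d : ℝ)) = (a ^ d * volume.real K) ^ (1 / (d : ℝ)) := by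
        rw [Real.mul_rpow (by positivity) measureReal_nonneg, one_div,
          Real.pow_rpow_inv_natCast ha hd]
    _ ≤ _ := Real.rpow_le_rpow (by positivity) h1 (by positivity)

/-- The Brunn–Minkowski inequality for nonempty compact sets. -/
theorem smul_volume_rpow_add_le {d : ℕ} (hd : d ≠ 0) {a b : ℝ} (ha : 0 < a) (hb : 0 < b)
    {K L : Set (Fin d → ℝ)} (hK : IsCompact K) (hL : IsCompact L)
    (hK0 : K.Nonempty) (hL0 : L.Nonempty) :
    a * volume.real K ^ (1 / (d : ℝ)) + b * volume.real L ^ (1 / (d : ℝ)) ≤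
      volume.real (a • K + b • L) ^ (1 / (d : ℝ)) := by
  have hd' : (1 / (d : ℝ)) ≠ 0 := by positivity
  rcases (measureReal_nonneg (μ := volume) (s := K)).eq_or_lt with hKv | hKv
  · rw [← hKv, Real.zero_rpow hd', mul_zero, zero_add, add_comm (a • K)]
    exact smul_volume_rpow_le_of_nonempty hd hb.le hL hK hK0
  rcases (measureReal_nonneg (μ := volume) (s := L)).eq_or_lt with hLv | hLv
  · rw [← hLv, Real.zero_rpow hd', mul_zero, add_zero]
    exact smul_volume_rpow_le_of_nonempty hd ha.le hK hL hL0
  set k := volume.real K ^ (1 / (d : ℝ)) with hk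
  set l := volume.real L ^ (1 / (d : ℝ)) with hl
  have hk0 : 0 < k := by positivity
  have hl0 : 0 < l := by positivity
  have hkd : k ^ d = volume.real K := by
    rw [hk, one_div, Real.rpow_inv_natCast_pow measureReal_nonneg hd]
  have hld : l ^ d = volume.real L := by
    rw [hl, one_div, Real.rpow_inv_natCast_pow measureReal_nonneg hd]
  set m := a * k + b * l with hm
  have hm0 : 0 < m := by positivity
  -- `K / k` and `L / l` have volume `1`, and with these weights their Minkowski combination is `(a
  -- K + b L) / m`.
  have h := volume_rpow_mul_volume_rpow_le (a := a * k / m) (b := b * l / m) (by positivity)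
    (by positivity) (by rw [← add_div, ← hm, div_self hm0.ne'])
    (hK.smul k⁻¹) (hL.smul l⁻¹)
  rw [volume_real_smul (by positivity), volume_real_smul (by positivity), ← hkd, ← hld,
    ← mul_pow, ← mul_pow, inv_mul_cancel₀ hk0.ne', inv_mul_cancel₀ hl0.ne', one_pow,
    Real.one_rpow, Real.one_rpow, one_mul, smul_smul, smul_smul,
    show a * k / m * k⁻¹ = m⁻¹ * a by field_simp, show b * l / m * l⁻¹ = m⁻¹ * b by field_simp,
    ← smul_smul, ← smul_smul, ← smul_add, volume_real_smul (by positivity), inv_pow,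
    inv_mul_eq_div, one_le_div (by positivity)] at h
  rw [one_div, Real.le_rpow_inv_iff_of_pos hm0.le measureReal_nonneg (by positivity),
    Real.rpow_natCast]
  exact h

/-- Brunn's theorem: the `(n-1)`-st root of the slice volume of a convex body is concave. -/
theorem concaveOn_sliceVol_rpow {d : ℕ} (hd : d ≠ 0) {Δ : Set (Fin (d + 1) → ℝ)}
    (hc : IsCompact Δ) (hconv : Convex ℝ Δ) {s : Set ℝ} (hs : Convex ℝ s)
    (hne : ∀ x ∈ s, (slice Δ x).Nonempty) :
    ConcaveOn ℝ s fun x => sliceVol Δ x ^ (1 / (d : ℝ)) := by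
  rw [concaveOn_iff_forall_pos]
  refine ⟨hs, fun x hx y hy a b ha hb hab => ?_⟩
  refine (smul_volume_rpow_add_le hd ha hb (isCompact_slice hc x) (isCompact_slice hc y)
    (hne x hx) (hne y hy)).trans ?_
  refine Real.rpow_le_rpow measureReal_nonneg (measureReal_mono ?_
    (isCompact_slice hc _).measure_lt_top.ne) (by positivity)
  refine (smul_slice_add_smul_slice_subset Δ Δ a b x y).trans fun z hz => ?_
  exact (convex_iff_pointwise_add_subset.1 hconv) ha.le hb.le hab hz

/-! ### The slice volume of a convex body as a function on the line -/

/-- A nonnegative integrable function supported on `[t₀, t₁]`, positive on `(t₀, t₁)`, whose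
`d`-th root is concave on `[t₀, t₁]`. -/
structure IsRootConcave (d : ℕ) (g : ℝ → ℝ) (t₀ t₁ : ℝ) : Prop where
  nonneg : ∀ x, 0 ≤ g x
  integrable : Integrable g
  pos : ∀ x ∈ Ioo t₀ t₁, 0 < g x
  eq_zero : ∀ x, x ∉ Icc t₀ t₁ → g x = 0
  concaveOn : ConcaveOn ℝ (Icc t₀ t₁) fun x => g x ^ (1 / (d : ℝ))

lemma pos_of_concaveOn_of_mem_openSegment {s : Set ℝ} {φ : ℝ → ℝ} (hφ : ConcaveOn ℝ s φ)
    {p q x : ℝ} (hp : p ∈ s) (hq : q ∈ s) (hp0 : 0 ≤ φ p) (hq0 : 0 < φ q)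
    (hx : x ∈ openSegment ℝ p q) : 0 < φ x := by
  obtain ⟨a, b, ha, hb, hab, rfl⟩ := hx
  refine lt_of_lt_of_le ?_ (hφ.2 hp hq ha.le hb.le hab)
  simp only [smul_eq_mul]
  positivity

lemma volume_real_pos_of_interior_nonempty {k : ℕ} {Δ : Set (Fin k → ℝ)} (hc : IsCompact Δ)
    (hint : (interior Δ).Nonempty) : 0 < volume.real Δ :=
  ENNReal.toReal_pos (Measure.measure_pos_of_nonempty_interior _ hint).ne' hc.measure_lt_top.ne

theorem isRootConcave_sliceVol {d : ℕ} (hd : d ≠ 0) {Δ : Set (Fin (d + 1) → ℝ)}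
    (hc : IsCompact Δ) (hconv : Convex ℝ Δ) (hint : (interior Δ).Nonempty) {t₀ t₁ : ℝ}
    (hproj : (fun y : Fin (d + 1) → ℝ => y 0) '' Δ = Icc t₀ t₁) :
    IsRootConcave d (sliceVol Δ) t₀ t₁ := by
  have hne : ∀ x ∈ Icc t₀ t₁, (slice Δ x).Nonempty := by
    intro x hx
    rw [← hproj] at hx
    obtain ⟨y, hy, rfl⟩ := hx
    refine ⟨Fin.tail y, ?_⟩
    change Fin.cons (y 0) (Fin.tail y) ∈ Δ
    rwa [Fin.cons_self_tail]
  have hconc := concaveOn_sliceVol_rpow hd hc hconv (convex_Icc t₀ t₁) hne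
  refine ⟨sliceVol_nonneg Δ, integrable_sliceVol hc, fun x hx => ?_, fun x hx => ?_, hconc⟩
  -- The slice through an interior point of `Δ` has positive volume; concavity of the root spreads
  -- positivity to all points strictly between the endpoints.
  · obtain ⟨y, hy⟩ := hint
    have hyI : y 0 ∈ Icc t₀ t₁ := hproj ▸ mem_image_of_mem _ (interior_subset hy)
    have hypos : 0 < sliceVol Δ (y 0) := by
      refine volume_real_pos_of_interior_nonempty (isCompact_slice hc _)
        ⟨Fin.tail y, mem_interior.2 ⟨(fun z => (Fin.cons (y 0) z : Fin (d + 1) → ℝ)) ⁻¹' interior Δ,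
          fun z hz => (interior_subset hz : (Fin.cons (y 0) z : Fin (d + 1) → ℝ) ∈ Δ), ?_, ?_⟩⟩
      · exact isOpen_interior.preimage
          ((continuous_cons_prod d).comp (continuous_const.prodMk continuous_id))
      · change Fin.cons (y 0) (Fin.tail y) ∈ interior Δ
        rwa [Fin.cons_self_tail]
    have hφ0 : ∀ x, 0 ≤ sliceVol Δ x ^ (1 / (d : ℝ)) := fun x =>
      Real.rpow_nonneg (sliceVol_nonneg Δ x) _
    have hφy : 0 < sliceVol Δ (y 0) ^ (1 / (d : ℝ)) := Real.rpow_pos_of_pos hypos _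
    have ht : t₀ ≤ t₁ := (hx.1.trans hx.2).le
    by_contra hcon
    have hx0 : sliceVol Δ x = 0 := le_antisymm (not_lt.1 hcon) (sliceVol_nonneg Δ x)
    have hφx : ¬ 0 < sliceVol Δ x ^ (1 / (d : ℝ)) := by
      rw [hx0, Real.zero_rpow (by positivity)]; exact lt_irrefl 0
    rcases lt_trichotomy x (y 0) with h | h | h
    · exact hφx (pos_of_concaveOn_of_mem_openSegment hconc (left_mem_Icc.2 ht) hyI (hφ0 _) hφy
        (by rw [openSegment_eq_Ioo (hx.1.trans h)]; exact ⟨hx.1, h⟩))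
    · exact hypos.ne' (h ▸ hx0)
    · exact hφx (pos_of_concaveOn_of_mem_openSegment hconc (right_mem_Icc.2 ht) hyI (hφ0 _) hφy
        (by rw [openSegment_symm, openSegment_eq_Ioo (h.trans hx.2)]; exact ⟨h, hx.2⟩))
  · have : slice Δ x = ∅ := by
      rw [eq_empty_iff_forall_notMem]
      intro y hy
      exact hx (hproj ▸ ⟨_, hy, Fin.cons_zero _ _⟩)
    simp [sliceVol, this]

theorem volume_mul_barycenter_zero {d : ℕ} {Δ : Set (Fin (d + 1) → ℝ)} (hc : IsCompact Δ) :
    barycenter Δ 0 = (volume.real Δ)⁻¹ * ∫ x, x * sliceVol Δ x := by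
  have hi : ∀ i, Integrable (fun y : Fin (d + 1) → ℝ => y i) (volume.restrict Δ) := fun i =>
    (continuous_apply i).continuousOn.integrableOn_compact hc
  have h := (integrable_and_setIntegral_eq_integral_slice hc (f := fun x => x) continuous_id).2
  rw [barycenter, Pi.smul_apply, smul_eq_mul, ← h, eval_integral hi]

/-! ### First moments of functions that cross once -/

lemma intervalIntegrable_id_mul {f : ℝ → ℝ} {a b : ℝ} (hf : IntervalIntegrable f volume a b) :
    IntervalIntegrable (fun x => x * f x) volume a b :=
  hf.continuousOn_mul continuousOn_id

lemma mul_integral_sub_le_of_crossing {f₁ f₂ : ℝ → ℝ} {a b r : ℝ} (hab : a ≤ b)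
    (h₁ : IntervalIntegrable f₁ volume a b) (h₂ : IntervalIntegrable f₂ volume a b)
    (hlt : ∀ x ∈ Ioo a b, x < r → f₂ x ≤ f₁ x) (hgt : ∀ x ∈ Ioo a b, r < x → f₁ x ≤ f₂ x) :
    r * ((∫ x in a..b, f₂ x) - ∫ x in a..b, f₁ x) ≤
      (∫ x in a..b, x * f₂ x) - ∫ x in a..b, x * f₁ x := by
  rw [← intervalIntegral.integral_sub h₂ h₁, ← intervalIntegral.integral_const_mul,
    ← intervalIntegral.integral_sub (intervalIntegrable_id_mul h₂) (intervalIntegrable_id_mul h₁)]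
  refine intervalIntegral.integral_mono_on_of_le_Ioo hab ((h₂.sub h₁).const_mul r)
    ((intervalIntegrable_id_mul h₂).sub (intervalIntegrable_id_mul h₁)) fun x hx => ?_
  rcases lt_trichotomy x r with h | h | h
  · nlinarith [hlt x hx h]
  · rw [h, mul_sub]
  · nlinarith [hgt x hx h]

/-- Moving mass to the left decreases the first moment: `h` lives on `[a, t]`, `g ≥ 0` on `[a, b]`,
both have the same mass, and `h` dominates `g` up to `r` and is dominated by it on `[r, t]`. -/
lemma integral_id_mul_le_of_crossing {g h : ℝ → ℝ} {a t b r : ℝ} (hat : a ≤ t) (htb : t ≤ b)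
    (hrt : r ≤ t) (hg : IntervalIntegrable g volume a b) (hh : IntervalIntegrable h volume a t)
    (hg0 : ∀ x, 0 ≤ g x) (hlt : ∀ x ∈ Ioo a t, x < r → g x ≤ h x)
    (hgt : ∀ x ∈ Ioo a t, r < x → h x ≤ g x)
    (hmass : ∫ x in a..t, h x = ∫ x in a..b, g x) :
    ∫ x in a..t, x * h x ≤ ∫ x in a..b, x * g x := by
  have hg₁ : IntervalIntegrable g volume a t :=
    hg.mono_set (by rw [uIcc_of_le hat, uIcc_of_le (hat.trans htb)]; exact Icc_subset_Icc_right htb)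
  have hg₂ : IntervalIntegrable g volume t b :=
    hg.mono_set (by rw [uIcc_of_le htb, uIcc_of_le (hat.trans htb)]; exact Icc_subset_Icc_left hat)
  have h1 := mul_integral_sub_le_of_crossing hat hh hg₁ hlt hgt
  have h2 := intervalIntegral.integral_add_adjacent_intervals hg₁ hg₂
  have h3 := intervalIntegral.integral_add_adjacent_intervals (intervalIntegrable_id_mul hg₁)
    (intervalIntegrable_id_mul hg₂)
  have h4 : r * ∫ x in t..b, g x ≤ ∫ x in t..b, x * g x := by
    rw [← intervalIntegral.integral_const_mul]
    refine intervalIntegral.integral_mono_on htb (hg₂.const_mul r) (intervalIntegrable_id_mul hg₂)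
      fun x hx => mul_le_mul_of_nonneg_right (hrt.trans hx.1) (hg0 x)
  have h5 : (∫ x in a..t, g x) - ∫ x in a..t, h x = -∫ x in t..b, g x := by
    rw [hmass, ← h2]; ring
  rw [h5] at h1
  linarith

/-! ### Gluing functions -/

lemma integral_ite_le {f k : ℝ → ℝ} {a c b : ℝ} (hac : a ≤ c) (hcb : c ≤ b)
    (hf : IntervalIntegrable f volume a c) (hk : IntervalIntegrable k volume c b) :
    IntervalIntegrable (fun x => if x ≤ c then f x else k x) volume a b ∧
      ∫ x in a..b, (if x ≤ c then f x else k x) = (∫ x in a..c, f x) + ∫ x in c..b, k x := by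
  have h1 : EqOn f (fun x => if x ≤ c then f x else k x) (uIoc a c) := by
    intro x hx
    rw [uIoc_of_le hac] at hx
    exact (if_pos hx.2).symm
  have h2 : EqOn k (fun x => if x ≤ c then f x else k x) (uIoc c b) := by
    intro x hx
    rw [uIoc_of_le hcb] at hx
    exact (if_neg (not_le.2 hx.1)).symm
  have h1i := hf.congr h1
  have h2i := hk.congr h2
  refine ⟨h1i.trans h2i, ?_⟩
  rw [← intervalIntegral.integral_add_adjacent_intervals h1i h2i,
    intervalIntegral.integral_congr_ae (ae_of_all _ h1),
    intervalIntegral.integral_congr_ae (ae_of_all _ h2)]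

/-! ### Crossing points of a concave and an affine function -/

lemma concaveOn_sub_affine {s : Set ℝ} {φ : ℝ → ℝ} (hφ : ConcaveOn ℝ s φ) (p q : ℝ) :
    ConcaveOn ℝ s fun x => φ x - (p * x + q) := by
  refine ⟨hφ.1, fun x hx y hy a b ha hb hab => ?_⟩
  have := hφ.2 hx hy ha hb hab
  simp only [smul_eq_mul] at *
  have : q = a * q + b * q := by rw [← add_mul, hab, one_mul]
  linarith

/-- The set where `φ` is at least the affine function is convex and contains `t`, so it is an
interval ending at `t`; `r` is its infimum. -/
lemma exists_crossing_of_le_right {φ : ℝ → ℝ} {s t : ℝ} (hst : s ≤ t)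
    (hφ : ConcaveOn ℝ (Icc s t) φ) (p q : ℝ) (ht : p * t + q ≤ φ t) :
    ∃ r ∈ Icc s t, (∀ x ∈ Icc s t, x < r → φ x ≤ p * x + q) ∧
      ∀ x ∈ Icc s t, r < x → p * x + q ≤ φ x := by
  set S := {x ∈ Icc s t | 0 ≤ φ x - (p * x + q)}
  have hconv : Convex ℝ S := (concaveOn_sub_affine hφ p q).convex_ge 0
  have htS : t ∈ S := ⟨right_mem_Icc.2 hst, sub_nonneg.2 ht⟩
  have hbdd : BddBelow S := ⟨s, fun x hx => hx.1.1⟩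
  refine ⟨sInf S, ⟨le_csInf ⟨t, htS⟩ fun x hx => hx.1.1, csInf_le hbdd htS⟩, ?_, ?_⟩
  · intro x hx hxr
    by_contra hcon
    exact absurd (csInf_le hbdd ⟨hx, sub_nonneg.2 (not_le.1 hcon).le⟩) (not_le.2 hxr)
  · intro x hx hxr
    obtain ⟨y, hy, hyx⟩ := exists_lt_of_csInf_lt ⟨t, htS⟩ hxr
    exact sub_nonneg.1 (hconv.ordConnected.out hy htS ⟨hyx.le, hx.2⟩).2

lemma exists_crossing_of_le_left {φ : ℝ → ℝ} {s t : ℝ} (hst : s ≤ t)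
    (hφ : ConcaveOn ℝ (Icc s t) φ) (p q : ℝ) (hs : p * s + q ≤ φ s) :
    ∃ r ∈ Icc s t, (∀ x ∈ Icc s t, x < r → p * x + q ≤ φ x) ∧
      ∀ x ∈ Icc s t, r < x → φ x ≤ p * x + q := by
  set S := {x ∈ Icc s t | 0 ≤ φ x - (p * x + q)}
  have hconv : Convex ℝ S := (concaveOn_sub_affine hφ p q).convex_ge 0
  have hsS : s ∈ S := ⟨left_mem_Icc.2 hst, sub_nonneg.2 hs⟩
  have hbdd : BddAbove S := ⟨t, fun x hx => hx.1.2⟩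
  refine ⟨sSup S, ⟨le_csSup hbdd hsS, csSup_le ⟨s, hsS⟩ fun x hx => hx.1.2⟩, ?_, ?_⟩
  · intro x hx hxr
    obtain ⟨y, hy, hyx⟩ := exists_lt_of_lt_csSup ⟨s, hsS⟩ hxr
    exact sub_nonneg.1 (hconv.ordConnected.out hsS hy ⟨hx.1, hyx.le⟩).2
  · intro x hx hxr
    by_contra hcon
    exact absurd (le_csSup hbdd ⟨hx, sub_nonneg.2 (not_le.1 hcon).le⟩) (not_le.2 hxr)

/-! ### Supporting lines -/

/-- Chord slopes of a concave function decrease, so either one-sided derivative at `e` is at least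
the slope of the chord from `e` to `x`. -/
lemma le_of_tendsto_slope_of_concaveOn {s : Set ℝ} {φ : ℝ → ℝ} (hφ : ConcaveOn ℝ s φ) {e m x : ℝ}
    (hs : s ∈ 𝓝 e) (hx : x ∈ s) (hex : e < x)
    (hm : Tendsto (slope φ e) (𝓝[>] e) (𝓝 m) ∨ Tendsto (slope φ e) (𝓝[<] e) (𝓝 m)) :
    φ x ≤ φ e + m * (x - e) := by
  have hes : e ∈ s := mem_of_mem_nhds hs
  have hx0 : 0 < x - e := sub_pos.2 hex
  have key : (φ x - φ e) / (x - e) ≤ m := by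
    rcases hm with hm | hm
    · refine ge_of_tendsto hm ?_
      filter_upwards [Ioo_mem_nhdsGT hex] with y hy
      have h := hφ.slope_anti_adjacent hes hx hy.1 hy.2
      have hy1 : 0 < y - e := sub_pos.2 hy.1
      have hy2 : 0 < x - y := sub_pos.2 hy.2
      rw [slope_def_field, div_le_div_iff₀ hx0 hy1]
      rw [div_le_div_iff₀ hy2 hy1] at h
      nlinarith
    · refine ge_of_tendsto hm ?_
      filter_upwards [self_mem_nhdsWithin, mem_nhdsWithin_of_mem_nhds hs] with y hy hys
      have h := hφ.slope_anti_adjacent hys hx hy hex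
      rwa [slope_comm, slope_def_field]
  rw [div_le_iff₀ hx0] at key
  linarith

lemma tendsto_slope_rpow {g : ℝ → ℝ} {e v p : ℝ} {s : Set ℝ} (hs : e ∉ s) (hge : 0 < g e)
    (hv : Tendsto (fun x => (g x - g e) / (x - e)) (𝓝[s] e) (𝓝 v)) :
    Tendsto (slope (fun x => g x ^ p) e) (𝓝[s] e) (𝓝 (v * p * g e ^ (p - 1))) := by
  have h : HasDerivWithinAt g v s e := by
    rw [hasDerivWithinAt_iff_tendsto_slope' hs]
    exact hv.congr fun x => (slope_def_field g e x).symm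
  exact (hasDerivWithinAt_iff_tendsto_slope' hs).1 (h.rpow_const (Or.inl hge.ne'))

/-! ### Integrals of powers of affine functions -/

/-- Keeping the factor `p` on the left avoids a case distinction at `p = 0`. -/
lemma integral_affine_pow (d : ℕ) (p q a b : ℝ) :
    (d + 1) * p * ∫ x in a..b, (p * x + q) ^ d = (p * b + q) ^ (d + 1) - (p * a + q) ^ (d + 1) := by
  rw [← intervalIntegral.integral_const_mul]
  refine intervalIntegral.integral_eq_sub_of_hasDerivAt (f := fun x => (p * x + q) ^ (d + 1))
    (fun x _ => ?_) (by apply Continuous.intervalIntegrable; fun_prop)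
  have h := (((hasDerivAt_id x).const_mul p).add_const q).pow (d + 1)
  refine h.congr_deriv ?_
  simp
  ring

lemma integral_cone (d : ℕ) (s t : ℝ) :
    ∫ x in s..t, ((t - x) / (t - s)) ^ d = (t - s) / (d + 1) := by
  rcases eq_or_ne s t with rfl | hst
  · simp
  have hst' : t - s ≠ 0 := sub_ne_zero.2 hst.symm
  have h := integral_affine_pow d (-(t - s)⁻¹) (t / (t - s)) s t
  have e1 : ∀ x, -(t - s)⁻¹ * x + t / (t - s) = (t - x) / (t - s) := fun x => by field_simp; ring
  simp only [e1, sub_self, zero_div, div_self hst', one_pow] at h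
  rw [zero_pow (Nat.succ_ne_zero d)] at h
  have hd : (d : ℝ) + 1 ≠ 0 := by positivity
  field_simp at h ⊢
  linarith

lemma integral_interpolation_pow (d : ℕ) {e u : ℝ} (heu : e ≠ u) (a w : ℝ) :
    (d + 1) * ∫ x in e..u, ((u - x) / (u - e) * a + (x - e) / (u - e) * w) ^ d =
      (u - e) * ∑ i ∈ Finset.range (d + 1), a ^ i * w ^ (d - i) := by
  have heu' : u - e ≠ 0 := sub_ne_zero.2 heu.symm
  have hsum := geom_sum₂_mul a w (d + 1)
  rw [Nat.add_sub_cancel] at hsum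
  rcases eq_or_ne a w with rfl | haw
  · have e1 : ∀ x, (u - x) / (u - e) * a + (x - e) / (u - e) * a = a := fun x => by
      field_simp; ring
    have e2 : ∀ i ∈ Finset.range (d + 1), a ^ i * a ^ (d - i) = a ^ d := fun i hi => by
      rw [← pow_add, Nat.add_sub_cancel' (Nat.lt_succ_iff.1 (Finset.mem_range.1 hi))]
    simp only [e1, Finset.sum_congr rfl e2, intervalIntegral.integral_const, smul_eq_mul,
      Finset.sum_const, Finset.card_range, nsmul_eq_mul]
    push_cast
    ring
  · have haw' : w - a ≠ 0 := sub_ne_zero.2 haw.symm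
    have h := integral_affine_pow d ((w - a) / (u - e)) ((u * a - e * w) / (u - e)) e u
    have e1 : ∀ x, (w - a) / (u - e) * x + (u * a - e * w) / (u - e) =
      (u - x) / (u - e) * a + (x - e) / (u - e) * w := fun x => by field_simp; ring
    simp only [e1, sub_self, zero_div, div_self heu', zero_mul, one_mul, zero_add, add_zero] at h
    refine mul_left_cancel₀ haw' ?_
    calc _ = (u - e) * ((d + 1) * ((w - a) / (u - e)) *
          ∫ x in e..u, ((u - x) / (u - e) * a + (x - e) / (u - e) * w) ^ d) := by
            field_simp
      _ = (u - e) * (w ^ (d + 1) - a ^ (d + 1)) := by rw [h]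
      _ = _ := by linear_combination (u - e) * hsum

lemma intervalIntegral_eq_integral_of_support {f : ℝ → ℝ} {a b u : ℝ} (hab : a ≤ b) (hbu : b ≤ u)
    (hf : ∀ x, x ∉ Icc a b → f x = 0) : ∫ x in a..u, f x = ∫ x, f x := by
  rw [intervalIntegral.integral_of_le (hab.trans hbu), ← integral_Icc_eq_integral_Ioc]
  exact setIntegral_eq_integral_of_forall_compl_eq_zero fun x hx =>
    hf x fun h => hx (Icc_subset_Icc_right hbu h)

/-! ### Mass equations for the tangent power and the cone, and their solutions `s₀` and `s₁` -/

/-- The affine function with value `1` at `e` and slope `v / (d g(e))`. -/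
noncomputable def tangentFactor (d : ℕ) (ge e v x : ℝ) : ℝ := v * (x - e) / (d * ge) + 1

lemma continuous_tangentFactor (d : ℕ) (ge e v : ℝ) : Continuous (tangentFactor d ge e v) := by
  unfold tangentFactor
  fun_prop

lemma tangentFactor_self (d : ℕ) (ge e v : ℝ) : tangentFactor d ge e v e = 1 := by
  simp [tangentFactor]

lemma tangentFactor_zero (d : ℕ) (ge e x : ℝ) : tangentFactor d ge e 0 x = 1 := by
  simp [tangentFactor]

lemma mul_tangentFactor {d : ℕ} (hd : d ≠ 0) {ge : ℝ} (hge : 0 < ge) (e v x : ℝ) :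
    d * ge * tangentFactor d ge e v x = v * (x - e) + d * ge := by
  have : (d : ℝ) ≠ 0 := Nat.cast_ne_zero.2 hd
  rw [tangentFactor]
  field_simp

lemma continuous_mul_tangentFactor_pow (d : ℕ) (ge e v : ℝ) :
    Continuous fun x => ge * tangentFactor d ge e v x ^ d :=
  continuous_const.mul ((continuous_tangentFactor d ge e v).pow d)

lemma mul_integral_tangentFactor_pow {d : ℕ} (hd : d ≠ 0) {ge : ℝ} (hge : 0 < ge) (e v s : ℝ) :
    (d + 1) * v * ∫ x in e..s, ge * tangentFactor d ge e v x ^ d =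
      d * ge ^ 2 * (tangentFactor d ge e v s ^ (d + 1) - 1) := by
  have hd' : (d : ℝ) ≠ 0 := Nat.cast_ne_zero.2 hd
  have h := integral_affine_pow d (v / (d * ge)) (1 - v * e / (d * ge)) e s
  have e1 : ∀ x, v / (d * ge) * x + (1 - v * e / (d * ge)) = tangentFactor d ge e v x := fun x => by
    rw [tangentFactor]; ring
  simp only [e1, tangentFactor_self, one_pow] at h
  rw [← h, intervalIntegral.integral_const_mul]
  field_simp

lemma integral_tangentFactor_zero (d : ℕ) (ge e s : ℝ) :
    ∫ x in e..s, ge * tangentFactor d ge e 0 x ^ d = ge * (s - e) := by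
  simp [tangentFactor_zero, mul_comm]

/-- The mass on `[e, t]` of the tangent power up to `s` followed by a cone with vertex `t`. -/
noncomputable def coneMass (d : ℕ) (ge e v t s : ℝ) : ℝ :=
  (∫ x in e..s, ge * tangentFactor d ge e v x ^ d) +
    ge * tangentFactor d ge e v s ^ d * ((t - s) / (d + 1))

lemma continuous_coneMass (d : ℕ) (ge e v t : ℝ) : Continuous (coneMass d ge e v t) := by
  unfold coneMass
  refine (intervalIntegral.continuous_primitive (fun a b =>
    (continuous_mul_tangentFactor_pow d ge e v).intervalIntegrable a b) e).add ?_
  exact (continuous_mul_tangentFactor_pow d ge e v).mul (by fun_prop)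

/-- The cone contributes a multiple of `v * (t - s)`, which is proportional to the difference of
tangent factors at `t` and `s`, so the powers of order `d + 1` cancel. Solving for the factor at `s`
yields `s₁`. If the factor at `t` vanishes and `v ≠ 0`, the mass does not depend on `s`: this is the
degenerate case. -/
lemma mul_coneMass {d : ℕ} (hd : d ≠ 0) {ge : ℝ} (hge : 0 < ge) (e v t s : ℝ) :
    (d + 1) * v * coneMass d ge e v t s =
      d * ge ^ 2 * (tangentFactor d ge e v s ^ d * tangentFactor d ge e v t - 1) := by
  have h1 := mul_integral_tangentFactor_pow hd hge e v s
  have h2 := mul_tangentFactor hd hge e v s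
  have h3 := mul_tangentFactor hd hge e v t
  have hd1 : (d : ℝ) + 1 ≠ 0 := by positivity
  have h4 : (d + 1) * v * (ge * tangentFactor d ge e v s ^ d * ((t - s) / (d + 1))) =
      v * (t - s) * (ge * tangentFactor d ge e v s ^ d) := by field_simp
  rw [coneMass, mul_add, h1, h4]
  linear_combination ge * tangentFactor d ge e v s ^ d * (h2 - h3)

lemma tangentFactor_sub_one_mul {d : ℕ} (hd : d ≠ 0) {ge : ℝ} (hge : 0 < ge) {v : ℝ} (hv : v ≠ 0)
    (e s : ℝ) : e + d * ge / v * (tangentFactor d ge e v s - 1) = s := by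
  have hd' : (d : ℝ) ≠ 0 := Nat.cast_ne_zero.2 hd
  rw [tangentFactor]
  field_simp
  ring

lemma s₀_eq_of_integral_eq {d : ℕ} (hd : d ≠ 0) {V A ge e v s : ℝ} (hge : 0 < ge)
    (hℓ : 0 ≤ tangentFactor d ge e v s)
    (hs : ∫ x in e..s, ge * tangentFactor d ge e v x ^ d = V - A) :
    s₀ d V A ge e v = s := by
  have hd' : (d : ℝ) ≠ 0 := Nat.cast_ne_zero.2 hd
  rw [s₀]
  split_ifs with hv
  · subst hv
    rw [← hs, integral_tangentFactor_zero]
    field_simp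
    ring
  · have h := mul_integral_tangentFactor_pow hd hge e v s
    rw [hs] at h
    have e1 : ((d + 1) * v * (V - A) + d * ge ^ 2) / (d * ge ^ 2) =
        tangentFactor d ge e v s ^ (d + 1) := by
      rw [h]; field_simp; ring
    have e2 : (1 : ℝ) / ((d : ℝ) + 1) = ((d + 1 : ℕ) : ℝ)⁻¹ := by push_cast; rw [one_div]
    rw [e1, e2, Real.pow_rpow_inv_natCast hℓ (Nat.succ_ne_zero d),
      tangentFactor_sub_one_mul hd hge hv]

lemma s₁_eq_of_coneMass_eq {d : ℕ} (hd : d ≠ 0) {V A ge e v t s : ℝ} (hge : 0 < ge)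
    (hℓ : 0 ≤ tangentFactor d ge e v s) (hs : coneMass d ge e v t s = V - A)
    (hdeg : v = 0 ∨ tangentFactor d ge e v t ≠ 0) :
    s₁ d V A ge e v t = s := by
  have hd' : (d : ℝ) ≠ 0 := Nat.cast_ne_zero.2 hd
  rw [s₁, ← mul_tangentFactor hd hge]
  split_ifs with hv ht
  · subst hv
    rw [← hs, coneMass, integral_tangentFactor_zero, tangentFactor_zero]
    have hd1 : (d : ℝ) + 1 ≠ 0 := by positivity
    field_simp
    ring
  · exact absurd ht (mul_ne_zero (mul_ne_zero hd' hge.ne') (hdeg.resolve_left hv))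
  · have h := mul_coneMass hd hge e v t s
    have ht' := hdeg.resolve_left hv
    rw [hs] at h
    have e1 : ((d + 1) * v * (V - A) + d * ge ^ 2) /
        (ge * (d * ge * tangentFactor d ge e v t)) = tangentFactor d ge e v s ^ d := by
      rw [h]; field_simp; ring
    rw [e1, one_div, Real.pow_rpow_inv_natCast hℓ hd, tangentFactor_sub_one_mul hd hge hv]

lemma s₁_of_tangentFactor_eq_zero {d : ℕ} (hd : d ≠ 0) {V A ge e v t : ℝ} (hge : 0 < ge)
    (hv : v ≠ 0) (ht : tangentFactor d ge e v t = 0) : s₁ d V A ge e v t = t := by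
  rw [s₁, if_neg hv, ← mul_tangentFactor hd hge, ht, mul_zero, if_pos rfl]

lemma h₀_of_le {d : ℕ} {g : ℝ → ℝ} {e v x : ℝ} (hx : e ≤ x) :
    h₀ d g e v x = g e * tangentFactor d (g e) e v x ^ d := by
  rcases hx.eq_or_lt with rfl | hx
  · rw [h₀, if_pos le_rfl, tangentFactor_self, one_pow, mul_one]
  · rw [h₀, if_neg (not_le.2 hx), tangentFactor]

/-! ### Comparison of a root-concave function with `h₀`, `h₁` and `h₂` -/

namespace IsRootConcave

variable {d : ℕ} {g : ℝ → ℝ} {t₀ t₁ e v : ℝ}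

lemma intervalIntegrable (hG : IsRootConcave d g t₀ t₁) (a b : ℝ) :
    IntervalIntegrable g volume a b :=
  hG.integrable.intervalIntegrable

lemma root_pow (hG : IsRootConcave d g t₀ t₁) (hd : d ≠ 0) (x : ℝ) :
    (g x ^ (1 / (d : ℝ))) ^ d = g x := by
  rw [one_div, Real.rpow_inv_natCast_pow (hG.nonneg x) hd]

lemma root_nonneg (hG : IsRootConcave d g t₀ t₁) (x : ℝ) : 0 ≤ g x ^ (1 / (d : ℝ)) :=
  Real.rpow_nonneg (hG.nonneg x) _

lemma integral_sub (hG : IsRootConcave d g t₀ t₁) :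
    (∫ x in t₀..t₁, g x) - ∫ x in t₀..e, g x = ∫ x in e..t₁, g x :=
  intervalIntegral.integral_interval_sub_left (hG.intervalIntegrable _ _)
    (hG.intervalIntegrable _ _)

lemma integral_pos (hG : IsRootConcave d g t₀ t₁) (he : e ∈ Ioo t₀ t₁) :
    0 < ∫ x in e..t₁, g x :=
  intervalIntegral.intervalIntegral_pos_of_pos_on (hG.intervalIntegrable _ _)
    (fun x hx => hG.pos x ⟨he.1.trans hx.1, hx.2⟩) he.2

lemma root_le_tangent (hG : IsRootConcave d g t₀ t₁) (hd : d ≠ 0) (he : e ∈ Ioo t₀ t₁)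
    (hv : Tendsto (fun x => (g x - g e) / (x - e)) (𝓝[>] e) (𝓝 v) ∨
      Tendsto (fun x => (g x - g e) / (x - e)) (𝓝[<] e) (𝓝 v)) {x : ℝ} (hx : x ∈ Icc e t₁) :
    g x ^ (1 / (d : ℝ)) ≤ g e ^ (1 / (d : ℝ)) * tangentFactor d (g e) e v x := by
  rcases hx.1.eq_or_lt with rfl | hex
  · rw [tangentFactor_self, mul_one]
  have hge := hG.pos e he
  have h := le_of_tendsto_slope_of_concaveOn hG.concaveOn (Icc_mem_nhds he.1 he.2)
    ⟨he.1.le.trans hx.1, hx.2⟩ hex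
    (hv.imp (tendsto_slope_rpow (by simp) hge) (tendsto_slope_rpow (by simp) hge))
  refine h.trans_eq ?_
  rw [Real.rpow_sub_one hge.ne', tangentFactor]
  have hd' : (d : ℝ) ≠ 0 := Nat.cast_ne_zero.2 hd
  field_simp
  ring

lemma tangentFactor_nonneg (hG : IsRootConcave d g t₀ t₁) (he : e ∈ Ioo t₀ t₁)
    (htan : ∀ x ∈ Icc e t₁,
      g x ^ (1 / (d : ℝ)) ≤ g e ^ (1 / (d : ℝ)) * tangentFactor d (g e) e v x)
    {x : ℝ} (hx : x ∈ Icc e t₁) : 0 ≤ tangentFactor d (g e) e v x :=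
  nonneg_of_mul_nonneg_right ((hG.root_nonneg x).trans (htan x hx))
    (Real.rpow_pos_of_pos (hG.pos e he) _)

lemma le_tangent_pow (hG : IsRootConcave d g t₀ t₁) (hd : d ≠ 0)
    (htan : ∀ x ∈ Icc e t₁,
      g x ^ (1 / (d : ℝ)) ≤ g e ^ (1 / (d : ℝ)) * tangentFactor d (g e) e v x)
    {x : ℝ} (hx : x ∈ Icc e t₁) : g x ≤ g e * tangentFactor d (g e) e v x ^ d := by
  have h := pow_le_pow_left₀ (hG.root_nonneg x) (htan x hx) d
  rwa [mul_pow, hG.root_pow hd, hG.root_pow hd] at h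

lemma le_h₀ (hG : IsRootConcave d g t₀ t₁) (hd : d ≠ 0)
    (htan : ∀ x ∈ Icc e t₁,
      g x ^ (1 / (d : ℝ)) ≤ g e ^ (1 / (d : ℝ)) * tangentFactor d (g e) e v x)
    {x : ℝ} (hx : x ≤ t₁) : g x ≤ h₀ d g e v x := by
  rcases le_total x e with h | h
  · rw [h₀, if_pos h]
  · rw [h₀_of_le h]
    exact hG.le_tangent_pow hd htan ⟨h, hx⟩

lemma integral_h₀ (hG : IsRootConcave d g t₀ t₁) (he : t₀ ≤ e) {t : ℝ} (ht : e ≤ t) :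
    IntervalIntegrable (h₀ d g e v) volume t₀ t ∧
      ∫ x in t₀..t, h₀ d g e v x =
        (∫ x in t₀..e, g x) + ∫ x in e..t, g e * tangentFactor d (g e) e v x ^ d :=
  integral_ite_le he ht (hG.intervalIntegrable _ _)
    ((continuous_mul_tangentFactor_pow d (g e) e v).intervalIntegrable _ _)

lemma integral_le_integral_tangent (hG : IsRootConcave d g t₀ t₁) (hd : d ≠ 0) (het : e ≤ t₁)
    (htan : ∀ x ∈ Icc e t₁,
      g x ^ (1 / (d : ℝ)) ≤ g e ^ (1 / (d : ℝ)) * tangentFactor d (g e) e v x) :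
    ∫ x in e..t₁, g x ≤ ∫ x in e..t₁, g e * tangentFactor d (g e) e v x ^ d :=
  intervalIntegral.integral_mono_on het (hG.intervalIntegrable _ _)
    ((continuous_mul_tangentFactor_pow d (g e) e v).intervalIntegrable _ _)
    fun _ hx => hG.le_tangent_pow hd htan hx

lemma s₀_spec (hG : IsRootConcave d g t₀ t₁) (hd : d ≠ 0) (he : e ∈ Ioo t₀ t₁)
    (htan : ∀ x ∈ Icc e t₁,
      g x ^ (1 / (d : ℝ)) ≤ g e ^ (1 / (d : ℝ)) * tangentFactor d (g e) e v x)
    {V A : ℝ} (hVA : V - A = ∫ x in e..t₁, g x) :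
    s₀ d V A (g e) e v ∈ Ioc e t₁ ∧
      ∫ x in e..s₀ d V A (g e) e v, g e * tangentFactor d (g e) e v x ^ d = V - A := by
  have hcont : Continuous fun s => ∫ x in e..s, g e * tangentFactor d (g e) e v x ^ d :=
    intervalIntegral.continuous_primitive (fun a b =>
      (continuous_mul_tangentFactor_pow d (g e) e v).intervalIntegrable a b) e
  have hpos : 0 < V - A := hVA ▸ hG.integral_pos he
  obtain ⟨s, hs, hsV⟩ := intermediate_value_Icc he.2.le hcont.continuousOn
    (show V - A ∈ Icc _ _ from ⟨by simpa using hpos.le,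
      hVA ▸ hG.integral_le_integral_tangent hd he.2.le htan⟩)
  dsimp only at hsV
  rw [s₀_eq_of_integral_eq hd (hG.pos e he) (hG.tangentFactor_nonneg he htan hs) hsV]
  refine ⟨⟨lt_of_le_of_ne hs.1 ?_, hs.2⟩, hsV⟩
  rintro rfl
  rw [intervalIntegral.integral_same] at hsV
  exact hpos.ne hsV

lemma cone_le (hG : IsRootConcave d g t₀ t₁) (hd : d ≠ 0) (he : e ∈ Ioo t₀ t₁) {x : ℝ}
    (hx : x ∈ Icc e t₁) : g e * ((t₁ - x) / (t₁ - e)) ^ d ≤ g x := by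
  have h0 : 0 < t₁ - e := sub_pos.2 he.2
  have h1 : 0 ≤ (t₁ - x) / (t₁ - e) := div_nonneg (sub_nonneg.2 hx.2) h0.le
  have h2 : 0 ≤ (x - e) / (t₁ - e) := div_nonneg (sub_nonneg.2 hx.1) h0.le
  have h := hG.concaveOn.2 (Ioo_subset_Icc_self he) (right_mem_Icc.2 (he.1.trans he.2).le) h1 h2
    (by field_simp; ring)
  simp only [smul_eq_mul] at h
  rw [show (t₁ - x) / (t₁ - e) * e + (x - e) / (t₁ - e) * t₁ = x by field_simp; ring] at h
  have h3 : (t₁ - x) / (t₁ - e) * g e ^ (1 / (d : ℝ)) ≤ g x ^ (1 / (d : ℝ)) :=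
    (le_add_of_nonneg_right (mul_nonneg h2 (hG.root_nonneg t₁))).trans h
  have h4 := pow_le_pow_left₀ (mul_nonneg h1 (hG.root_nonneg e)) h3 d
  rwa [mul_pow, hG.root_pow hd, hG.root_pow hd, mul_comm] at h4

lemma integral_cone_le (hG : IsRootConcave d g t₀ t₁) (hd : d ≠ 0) (he : e ∈ Ioo t₀ t₁) :
    ∫ x in e..t₁, g e * ((t₁ - x) / (t₁ - e)) ^ d ≤ ∫ x in e..t₁, g x :=
  intervalIntegral.integral_mono_on he.2.le (by apply Continuous.intervalIntegrable; fun_prop)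
    (hG.intervalIntegrable _ _) fun _ hx => hG.cone_le hd he hx

lemma s₁_spec (hG : IsRootConcave d g t₀ t₁) (hd : d ≠ 0) (he : e ∈ Ioo t₀ t₁)
    (htan : ∀ x ∈ Icc e t₁,
      g x ^ (1 / (d : ℝ)) ≤ g e ^ (1 / (d : ℝ)) * tangentFactor d (g e) e v x)
    {V A t : ℝ} (hVA : V - A = ∫ x in e..t₁, g x) (ht : t ∈ Ioc e t₁)
    (htV : V - A ≤ ∫ x in e..t, g e * tangentFactor d (g e) e v x ^ d) :
    s₁ d V A (g e) e v t ∈ Icc e t ∧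
      coneMass d (g e) e v t (s₁ d V A (g e) e v t) = V - A := by
  have hge := hG.pos e he
  -- At `s = e` only a cone remains, no heavier than the cone with vertex `t₁`, which lies below
  -- `g`; at `s = t` only the tangent power remains.
  have hlow : coneMass d (g e) e v t e ≤ V - A := by
    rw [coneMass, intervalIntegral.integral_same, tangentFactor_self, one_pow, mul_one, zero_add,
      hVA]
    refine le_trans ?_ (hG.integral_cone_le hd he)
    rw [intervalIntegral.integral_const_mul, integral_cone]
    gcongr
    exact ht.2
  have hhigh : V - A ≤ coneMass d (g e) e v t t := by
    simpa [coneMass] using htV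
  obtain ⟨s, hs, hsV⟩ := intermediate_value_Icc ht.1.le
    (continuous_coneMass d (g e) e v t).continuousOn ⟨hlow, hhigh⟩
  by_cases hdeg : v = 0 ∨ tangentFactor d (g e) e v t ≠ 0
  · rw [s₁_eq_of_coneMass_eq hd hge
      (hG.tangentFactor_nonneg he htan ⟨hs.1, hs.2.trans ht.2⟩) hsV hdeg]
    exact ⟨hs, hsV⟩
  · push Not at hdeg
    rw [s₁_of_tangentFactor_eq_zero hd hge hdeg.1 hdeg.2]
    refine ⟨right_mem_Icc.2 ht.1.le, ?_⟩
    rw [← hsV]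
    have hd1 : (d : ℝ) + 1 ≠ 0 := by positivity
    refine mul_left_cancel₀ (mul_ne_zero hd1 hdeg.1) ?_
    rw [mul_coneMass hd hge, mul_coneMass hd hge, hdeg.2, mul_zero, mul_zero]

/-- The first moment of `g` is at least that of the tangent power with the same mass. -/
lemma integral_id_mul_h₀_le (hG : IsRootConcave d g t₀ t₁) (hd : d ≠ 0) (he : t₀ ≤ e)
    (htan : ∀ x ∈ Icc e t₁,
      g x ^ (1 / (d : ℝ)) ≤ g e ^ (1 / (d : ℝ)) * tangentFactor d (g e) e v x)
    {s : ℝ} (hs : s ∈ Ioc e t₁)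
    (hmass : ∫ x in e..s, g e * tangentFactor d (g e) e v x ^ d = ∫ x in e..t₁, g x) :
    ∫ x in t₀..s, x * h₀ d g e v x ≤ ∫ x in t₀..t₁, x * g x := by
  obtain ⟨h1, h2⟩ := hG.integral_h₀ (v := v) he hs.1.le
  -- With `r = s` there is nothing to check beyond the crossing: `h₀` dominates `g` on the whole
  -- interval.
  refine integral_id_mul_le_of_crossing (r := s) (he.trans hs.1.le) hs.2 le_rfl
    (hG.intervalIntegrable _ _) h1 hG.nonneg
    (fun x hx _ => hG.le_h₀ hd htan (hx.2.le.trans hs.2))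
    (fun x hx h => absurd h (not_lt.2 hx.2.le)) ?_
  rw [h2, hmass, intervalIntegral.integral_add_adjacent_intervals (hG.intervalIntegrable _ _)
    (hG.intervalIntegrable _ _)]

/-- The first moment of `g` is at least that of the tangent power followed by a cone, if both have
the same mass. -/
lemma integral_id_mul_h₁_le (hG : IsRootConcave d g t₀ t₁) (hd : d ≠ 0) (he : e ∈ Ioo t₀ t₁)
    (htan : ∀ x ∈ Icc e t₁,
      g x ^ (1 / (d : ℝ)) ≤ g e ^ (1 / (d : ℝ)) * tangentFactor d (g e) e v x)
    {s t : ℝ} (hs : s ∈ Icc e t) (ht : t ≤ t₁)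
    (hmass : coneMass d (g e) e v t s = ∫ x in e..t₁, g x) :
    ∫ x in t₀..t, x * h₁ d g e v t s x ≤ ∫ x in t₀..t₁, x * g x := by
  obtain ⟨h1, h2⟩ := hG.integral_h₀ (v := v) he.1.le hs.1
  obtain ⟨h3, h4⟩ := integral_ite_le (c := s) (b := t) (he.1.le.trans hs.1) hs.2 h1
    (k := fun x => h₀ d g e v s * ((t - x) / (t - s)) ^ d)
    (by apply Continuous.intervalIntegrable; fun_prop)
  have hℓ := hG.tangentFactor_nonneg he htan ⟨hs.1, hs.2.trans ht⟩
  set κ := g e ^ (1 / (d : ℝ)) * tangentFactor d (g e) e v s with hκ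
  have hκ0 : 0 ≤ κ := mul_nonneg (hG.root_nonneg e) hℓ
  have hκd : κ ^ d = h₀ d g e v s := by
    rw [hκ, mul_pow, hG.root_pow hd, h₀_of_le hs.1]
  -- The line falls from `κ` at `s` to `0` at `t`, where the root of `g` is nonnegative. For `s = t`
  -- division by zero makes it the zero line, so the endpoint condition still holds.
  obtain ⟨r, hr, hlt, hgt⟩ := exists_crossing_of_le_right hs.2
    (hG.concaveOn.subset (Icc_subset_Icc (he.1.le.trans hs.1) ht) (convex_Icc s t))
    (-(κ / (t - s))) (κ * t / (t - s)) (by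
      refine le_trans (le_of_eq ?_) (hG.root_nonneg t)
      ring)
  have haff : ∀ x, -(κ / (t - s)) * x + κ * t / (t - s) = κ * ((t - x) / (t - s)) := fun x => by
    ring
  simp only [haff] at hlt hgt
  have hle : ∀ x, x ≤ s → h₁ d g e v t s x = h₀ d g e v x := fun x hx => if_pos hx
  have hcone : ∀ x, s < x → h₁ d g e v t s x = (κ * ((t - x) / (t - s))) ^ d := fun x hx => by
    rw [h₁, if_neg (not_le.2 hx), mul_pow, hκd]
  refine integral_id_mul_le_of_crossing (r := r) (he.1.le.trans (hs.1.trans hs.2)) ht hr.2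
    (hG.intervalIntegrable _ _) h3 hG.nonneg (fun x hx hxr => ?_) (fun x hx hxr => ?_) ?_
  · rcases le_or_gt x s with h | h
    · rw [hle x h]
      exact hG.le_h₀ hd htan (hx.2.le.trans ht)
    · rw [hcone x h, ← hG.root_pow hd x]
      exact pow_le_pow_left₀ (hG.root_nonneg x) (hlt x ⟨h.le, hx.2.le⟩ hxr) d
  · have h : s < x := hr.1.trans_lt hxr
    change h₁ d g e v t s x ≤ g x
    rw [hcone x h, ← hG.root_pow hd x]
    refine pow_le_pow_left₀ (mul_nonneg hκ0 (div_nonneg (sub_nonneg.2 hx.2.le) ?_))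
      (hgt x ⟨h.le, hx.2.le⟩ hxr) d
    linarith [hx.2]
  · refine h4.trans ?_
    rw [intervalIntegral.integral_const_mul, integral_cone, h2, h₀_of_le hs.1, add_assoc]
    change _ + coneMass d (g e) e v t s = _
    rw [hmass, intervalIntegral.integral_add_adjacent_intervals (hG.intervalIntegrable _ _)
      (hG.intervalIntegrable _ _)]

lemma integral_h₂ (hG : IsRootConcave d g t₀ t₁) (he : t₀ ≤ e) {u : ℝ} (hu : e ≤ u) (w : ℝ) :
    IntervalIntegrable (h₂ d g e u w) volume t₀ u ∧
      ∫ x in t₀..u, h₂ d g e u w x = (∫ x in t₀..e, g x) +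
        ∫ x in e..u, ((u - x) / (u - e) * g e ^ (1 / (d : ℝ)) + (x - e) / (u - e) * w) ^ d :=
  integral_ite_le he hu (hG.intervalIntegrable _ _)
    (by apply Continuous.intervalIntegrable; fun_prop)

/-- Turns the sign condition on `F` into a comparison of masses. -/
lemma F_eq_integral_h₂ (hG : IsRootConcave d g t₀ t₁) (he : t₀ ≤ e) {u : ℝ} (hu : e < u) (V w : ℝ) :
    F d V (∫ x in t₀..e, g x) (g e) e u w =
      (d + 1) * ((∫ x in t₀..u, h₂ d g e u w x) - V) := by
  have hpow : ∀ i : ℕ, (g e ^ (1 / (d : ℝ))) ^ i = g e ^ ((i : ℝ) / (d : ℝ)) := fun i => by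
    rw [← Real.rpow_mul_natCast (hG.nonneg e)]
    congr 1
    ring
  have h := integral_interpolation_pow d hu.ne (g e ^ (1 / (d : ℝ))) w
  simp only [hpow] at h
  rw [F, ← h, (hG.integral_h₂ he hu.le w).2]
  ring

/-- The first moment of `g` is at most that of `h₂`, if `h₂` has at least the mass of `g`. -/
lemma integral_id_mul_le_h₂ (hG : IsRootConcave d g t₀ t₁) (hd : d ≠ 0) (he : e ∈ Ioo t₀ t₁)
    {u w : ℝ} (hu : t₁ ≤ u) (hw : 0 ≤ w)
    (hmass : ∫ x in t₀..u, g x ≤ ∫ x in t₀..u, h₂ d g e u w x)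
    (hcase : 0 ≤ e ∨ ∫ x in t₀..u, h₂ d g e u w x = ∫ x in t₀..u, g x) :
    ∫ x in t₀..u, x * g x ≤ ∫ x in t₀..u, x * h₂ d g e u w x := by
  have heu : e < u := he.2.trans_le hu
  have heu0 : 0 < u - e := sub_pos.2 heu
  obtain ⟨h1, -⟩ := hG.integral_h₂ he.1.le heu.le w
  set a := g e ^ (1 / (d : ℝ)) with ha
  have haff : ∀ x, (w - a) / (u - e) * x + (u * a - e * w) / (u - e) =
      (u - x) / (u - e) * a + (x - e) / (u - e) * w := fun x => by field_simp; ring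
  -- The interpolating line agrees with the root of `g` at `e`, hence crosses it at most once on
  -- `[e, t₁]`; beyond `t₁` the function `g` vanishes.
  obtain ⟨r, hr, hlt, hgt⟩ := exists_crossing_of_le_left he.2.le
    (hG.concaveOn.subset (Icc_subset_Icc_left he.1.le) (convex_Icc e t₁))
    ((w - a) / (u - e)) ((u * a - e * w) / (u - e)) (by
      rw [haff, sub_self, zero_div, zero_mul, add_zero, div_self heu0.ne', one_mul])
  simp only [haff] at hlt hgt
  have hnonneg : ∀ x ∈ Icc e u, 0 ≤ (u - x) / (u - e) * a + (x - e) / (u - e) * w := fun x hx =>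
    add_nonneg (mul_nonneg (div_nonneg (sub_nonneg.2 hx.2) heu0.le) (hG.root_nonneg e))
      (mul_nonneg (div_nonneg (sub_nonneg.2 hx.1) heu0.le) hw)
  have hle : ∀ x, x ≤ e → h₂ d g e u w x = g x := fun x hx => if_pos hx
  have hint : ∀ x, e < x → h₂ d g e u w x =
      ((u - x) / (u - e) * a + (x - e) / (u - e) * w) ^ d := fun x hx => if_neg (not_le.2 hx)
  have key := mul_integral_sub_le_of_crossing (r := r) (he.1.le.trans heu.le)
    (hG.intervalIntegrable _ _) h1 (fun x hx hxr => ?_) (fun x hx hxr => ?_)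
  -- Excess mass is harmless when `r ≥ e ≥ 0`; otherwise there is none.
  · have h0 : 0 ≤ r * ((∫ x in t₀..u, h₂ d g e u w x) - ∫ x in t₀..u, g x) := by
      rcases hcase with h | h
      · exact mul_nonneg (h.trans hr.1) (sub_nonneg.2 hmass)
      · rw [h, sub_self, mul_zero]
    linarith
  · rcases le_or_gt x e with h | h
    · exact (hle x h).le
    · rw [hint x h, ← hG.root_pow hd x]
      exact pow_le_pow_left₀ (hnonneg x ⟨h.le, hx.2.le⟩) (hlt x ⟨h.le, hxr.le.trans hr.2⟩ hxr) d
  · have h : e < x := hr.1.trans_lt hxr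
    rw [hint x h]
    rcases le_or_gt x t₁ with h' | h'
    · rw [← hG.root_pow hd x]
      exact pow_le_pow_left₀ (hG.root_nonneg x) (hgt x ⟨h.le, h'⟩ hxr) d
    · rw [hG.eq_zero x fun hx' => absurd hx'.2 (not_le.2 h')]
      exact pow_nonneg (hnonneg x ⟨h.le, hx.2.le⟩) d

end IsRootConcave

end ConvexSlice

/-! ### Assembly of the barycenter bounds -/

theorem mainTheorem11 (d : ℕ) (hd : 1 ≤ d) (Δ : Set (Fin (d + 1) → ℝ))
    (hΔc : IsCompact Δ) (hΔconv : Convex ℝ Δ) (hΔint : (interior Δ).Nonempty)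
    (t₀ t₁ : ℝ) (hproj : (fun y : Fin (d + 1) → ℝ => y 0) '' Δ = Icc t₀ t₁)
    (V : ℝ) (hV : V = volume.real Δ)
    (b₁ : ℝ) (hb₁ : b₁ = ConvexSlice.barycenter Δ 0)
    (g : ℝ → ℝ) (hg : g = ConvexSlice.sliceVol Δ)
    (e : ℝ) (he : e ∈ Ioo t₀ t₁)
    (A : ℝ) (hA : A = ∫ x in t₀..e, g x) :
    (∀ v : ℝ,
      (Tendsto (fun x => (g x - g e) / (x - e)) (𝓝[>] e) (𝓝 v) ∨
        Tendsto (fun x => (g x - g e) / (x - e)) (𝓝[<] e) (𝓝 v)) →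
      ((∀ x ∈ Icc t₀ t₁, g x ≤ ConvexSlice.h₀ d g e v x) ∧
        ConvexSlice.s₀ d V A (g e) e v ∈ Ioc e t₁ ∧
        (1 / V) * (∫ x in t₀..(ConvexSlice.s₀ d V A (g e) e v),
          x * ConvexSlice.h₀ d g e v x) ≤ b₁) ∧
      V ≤ (∫ x in t₀..t₁, ConvexSlice.h₀ d g e v x) ∧
      (∀ t ∈ Ioc e t₁, ∀ W : ℝ, W = (∫ x in t₀..t, ConvexSlice.h₀ d g e v x) →
        (v ≠ 0 → W = A + d * g e ^ 2 / ((d + 1) * v) *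
          ((v * (t - e) / (d * g e) + 1) ^ (d + 1) - 1)) ∧
        (v = 0 → W = A + (t - e) * g e) ∧
        (V ≤ W → ∀ s : ℝ, s = ConvexSlice.s₁ d V A (g e) e v t →
          s ∈ Icc e t ∧
          (v ≠ 0 → v * (t - e) + d * g e ≠ 0 →
            s = e + d * g e / v *
              (((d * g e ^ 2 * (v * (t - e) / (d * g e) + 1) ^ (d + 1)
                - (d + 1) * v * (W - V)) / (g e * (v * (t - e) + d * g e))) ^ (1 / (d : ℝ))
                - 1)) ∧
          (v = 0 → s = t - (d + 1) * (W - V) / (d * g e)) ∧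
          (1 / V) * (∫ x in t₀..t, x * ConvexSlice.h₁ d g e v t s x) ≤ b₁))) ∧
    (A + (∫ x in e..t₁, g e * ((t₁ - x) / (t₁ - e)) ^ d) ≤ V ∧
      ∀ u : ℝ, t₁ ≤ u →
        (∫ x in e..u, g e * ((u - x) / (u - e)) ^ d) = (u - e) * g e / (d + 1) ∧
        (A + (∫ x in e..u, g e * ((u - x) / (u - e)) ^ d) ≤ V →
          ∀ w : ℝ, 0 ≤ w → 0 ≤ ConvexSlice.F d V A (g e) e u w →
            (0 ≤ e ∨ ConvexSlice.F d V A (g e) e u w = 0) →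
            b₁ ≤ (1 / V) * ∫ x in t₀..u, x * ConvexSlice.h₂ d g e u w x)) := by
  have hd0 : d ≠ 0 := Nat.one_le_iff_ne_zero.1 hd
  have hdR : (d : ℝ) ≠ 0 := Nat.cast_ne_zero.2 hd0
  have hd1 : (d : ℝ) + 1 ≠ 0 := by positivity
  have hVpos : 0 < V := hV ▸ ConvexSlice.volume_real_pos_of_interior_nonempty hΔc hΔint
  have hG : ConvexSlice.IsRootConcave d g t₀ t₁ :=
    hg ▸ ConvexSlice.isRootConcave_sliceVol hd0 hΔc hΔconv hΔint hproj
  have ht : t₀ ≤ t₁ := (he.1.trans he.2).le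
  have hge : 0 < g e := hG.pos e he
  have hVu : ∀ u, t₁ ≤ u → ∫ x in t₀..u, g x = V := fun u hu => by
    rw [ConvexSlice.intervalIntegral_eq_integral_of_support ht hu hG.eq_zero, hV, hg,
      ConvexSlice.volume_real_eq_integral_sliceVol hΔc]
  have hbu : ∀ u, t₁ ≤ u → b₁ = 1 / V * ∫ x in t₀..u, x * g x := fun u hu => by
    rw [ConvexSlice.intervalIntegral_eq_integral_of_support ht hu
      (fun x hx => by rw [hG.eq_zero x hx, mul_zero]), hb₁,
      ConvexSlice.volume_mul_barycenter_zero hΔc, hV, hg, one_div]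
  have hVA : V - A = ∫ x in e..t₁, g x := by rw [← hVu t₁ le_rfl, hA, hG.integral_sub]
  have hV0 : 0 ≤ 1 / V := by positivity
  refine ⟨fun v hv => ?_, ?_, fun u hu => ⟨?_, fun _ w hw hF hcase => ?_⟩⟩
  · have htan := fun x hx => hG.root_le_tangent hd0 he hv (x := x) hx
    obtain ⟨hs₀, hs₀V⟩ := hG.s₀_spec hd0 he htan hVA
    refine ⟨⟨fun x hx => hG.le_h₀ hd0 htan hx.2, hs₀, ?_⟩, ?_, fun t ht' W hW => ?_⟩
    · rw [hbu t₁ le_rfl]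
      exact mul_le_mul_of_nonneg_left
        (hG.integral_id_mul_h₀_le hd0 he.1.le htan hs₀ (hs₀V.trans hVA)) hV0
    · rw [(hG.integral_h₀ he.1.le he.2.le).2, ← hA]
      linarith [hG.integral_le_integral_tangent hd0 he.2.le htan]
    · have hWA : W - A = ∫ x in e..t, g e * ConvexSlice.tangentFactor d (g e) e v x ^ d := by
        rw [hW, (hG.integral_h₀ he.1.le ht'.1.le).2, ← hA]
        ring
      have hWv := ConvexSlice.mul_integral_tangentFactor_pow hd0 hge e v t
      rw [← hWA, ConvexSlice.tangentFactor] at hWv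
      have hW0 : v = 0 → W = A + (t - e) * g e := fun hv0 => by
        rw [hv0, ConvexSlice.integral_tangentFactor_zero] at hWA
        linarith
      refine ⟨fun hv0 => ?_, hW0, fun hVW s hs => ?_⟩
      · have : W - A = d * g e ^ 2 / ((d + 1) * v) *
            ((v * (t - e) / (d * g e) + 1) ^ (d + 1) - 1) := by
          rw [div_mul_eq_mul_div, eq_div_iff (mul_ne_zero hd1 hv0), ← hWv, mul_comm]
        linarith
      · obtain ⟨hs₁, hs₁V⟩ := hG.s₁_spec hd0 he htan hVA ht' (by linarith)
        rw [← hs] at hs₁ hs₁V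
        refine ⟨hs₁, fun hv0 hdeg => ?_, fun hv0 => ?_, ?_⟩
        · rw [hs, ConvexSlice.s₁, if_neg hv0, if_neg hdeg]
          -- The two formulas for `s₁` differ only in a numerator, which the closed form of `W`
          -- reconciles.
          congr 5
          linear_combination hWv
        · rw [hs, ConvexSlice.s₁, if_pos hv0, hW0 hv0]
          field_simp
          ring
        · rw [hbu t₁ le_rfl]
          exact mul_le_mul_of_nonneg_left
            (hG.integral_id_mul_h₁_le hd0 he htan hs₁ ht'.2 (hs₁V.trans hVA)) hV0
  · linarith [hG.integral_cone_le hd0 he]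
  · rw [intervalIntegral.integral_const_mul, ConvexSlice.integral_cone]
    ring
  · rw [hA, hG.F_eq_integral_h₂ he.1.le (he.2.trans_le hu)] at hF hcase
    rw [hbu u hu]
    refine mul_le_mul_of_nonneg_left (hG.integral_id_mul_le_h₂ hd0 he hu hw ?_ ?_) hV0
    · rw [hVu u hu]
      exact sub_nonneg.1 (nonneg_of_mul_nonneg_right hF (by positivity))
    · rw [hVu u hu]
      exact hcase.imp_right fun h => sub_eq_zero.1 ((mul_eq_zero.1 h).resolve_left hd1)
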